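/- Let $a,b>0$ be real numbers with $2a+b<2$, and let $L$ be the operator in the complex Hilbert space $L^2(-\pi,\pi)$ given by $$(Ly)(x)=\frac{d}{dx}\Big((1-a\cos x)\,y(x)+b\,\sin x\cdot y'(x)\Big),$$ whose domain $\mathfrak D(L)$ consists of all functions $y$ that are absolutely continuous on $[-\pi,\pi]$, satisfy $y(-\pi)=y(\pi)$, and are such that $Ly\in L^2(-\pi,\pi)$ (the outer derivative being taken in the weak sense on $(-\pi,\pi)$). Then $$\mathfrak D(L)=\{f\in H^1(-\pi,\pi)\;:\; f(\pi)=f(-\pi),\ \sin(x)f'\in H^1(-\pi,\pi)\},$$ where $f'$ is the weak derivative and $f(\pm\pi)$ are the values of the representative of $f$ that is continuous on $[-\pi,\pi]$. Moreover, $\mathfrak D(L)$ is a Hilbert space under the norm defined by $$\|f\|^2=\|f\|_{H^1}^2+\|\sin(x)f'\|_{H^1}^2,\qquad \|g\|_{H^1}^2=\int_{-\pi}^{\pi}|g|^2\,dx+\int_{-\pi}^{\pi}|g'|^2\,dx .$$ -/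

import Mathlib

open MeasureTheory Set

open scoped ContDiff

noncomputable section

namespace ConvDiff

/-- Lebesgue measure on the interval `(-π, π)`. -/
abbrev muPi : Measure ℝ := volume.restrict (Ioo (-Real.pi) Real.pi)

/-- The complex Hilbert space `L²(-π, π)`. -/
abbrev L2 : Type := Lp ℂ 2 muPi

/-- `g` is a weak (distributional) derivative of `f` on `(-π, π)`: both functions are locally
integrable on `(-π, π)`, and `∫ φ' f = - ∫ φ g` for all test functions `φ ∈ C_c^∞(-π, π)`. -/
def HasWeakDeriv (f g : ℝ → ℂ) : Prop :=
  LocallyIntegrableOn f (Ioo (-Real.pi) Real.pi) volume ∧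
  LocallyIntegrableOn g (Ioo (-Real.pi) Real.pi) volume ∧
  ∀ φ : ℝ → ℝ, ContDiff ℝ ∞ φ → HasCompactSupport φ → tsupport φ ⊆ Ioo (-Real.pi) Real.pi →
    ∫ x, deriv φ x • f x ∂muPi = -∫ x, φ x • g x ∂muPi

/-- `f` belongs to the Sobolev space `H¹(-π, π)`. -/
def MemH1 (f : ℝ → ℂ) : Prop :=
  MemLp f 2 muPi ∧ ∃ g : ℝ → ℂ, HasWeakDeriv f g ∧ MemLp g 2 muPi

open Classical in
/-- The weak derivative on `(-π, π)` (unique up to null sets, see `HasWeakDeriv.ae_unique`);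
by convention it is `0` if `f` has no weak derivative. -/
def weakDeriv (f : ℝ → ℂ) : ℝ → ℂ :=
  if h : ∃ g : ℝ → ℂ, HasWeakDeriv f g then h.choose else 0

/-- The square `‖f‖²_{L²} + ‖f'‖²_{L²}` of the norm of `H¹(-π, π)`, for `f ∈ H¹(-π, π)`. -/
def h1NormSq (f : ℝ → ℂ) : ℝ :=
  ∫ x, ‖f x‖ ^ 2 ∂muPi + ∫ x, ‖weakDeriv f x‖ ^ 2 ∂muPi

/-- `f(π) = f(-π)`, for the representative of `f` that is continuous on `[-π, π]`. -/
def EqualEndpoints (f : ℝ → ℂ) : Prop :=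
  ∃ g : ℝ → ℂ, ContinuousOn g (Icc (-Real.pi) Real.pi) ∧ f =ᵐ[muPi] g ∧
    g Real.pi = g (-Real.pi)

/-- The function `sin(x) f'(x)`. -/
def sinDeriv (f : ℝ → ℂ) : ℝ → ℂ := fun x => (Real.sin x : ℂ) * weakDeriv f x

/-- The expression `(1 - a cos x) y(x) + b sin x y'(x)`, for an absolutely continuous `y`
(for which the classical derivative `y'` exists almost everywhere). -/
def flux (a b : ℝ) (y : ℝ → ℂ) : ℝ → ℂ := fun x =>
  (1 - (a : ℂ) * (Real.cos x : ℂ)) * y x + (b : ℂ) * (Real.sin x : ℂ) * deriv y x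

/-! ### Elementary facts, needed for the definition of the operator -/

lemma integrable_test_smul {f : ℝ → ℂ} {φ : ℝ → ℝ}
    (hf : LocallyIntegrableOn f (Ioo (-Real.pi) Real.pi) volume)
    (hφ : Continuous φ) (hc : HasCompactSupport φ)
    (hs : tsupport φ ⊆ Ioo (-Real.pi) Real.pi) : Integrable (fun x => φ x • f x) muPi := by
  have hK : IntegrableOn f (tsupport φ) volume := hf.integrableOn_compact_subset hs hc
  have h1 : IntegrableOn (fun x => φ x • f x) (tsupport φ) volume :=
    hK.continuousOn_smul hφ.continuousOn hc
  refine ((integrableOn_iff_integrable_of_support_subset ?_).1 h1).restrict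
  intro x hx
  refine subset_tsupport φ ?_
  rw [Function.mem_support] at hx ⊢
  intro h
  exact hx (by simp [h])

lemma HasWeakDeriv.congr {f f' g g' : ℝ → ℂ} (h : HasWeakDeriv f g)
    (hf : f =ᵐ[muPi] f') (hg : g =ᵐ[muPi] g') : HasWeakDeriv f' g' := by
  have key : ∀ {u v : ℝ → ℂ}, u =ᵐ[muPi] v →
      LocallyIntegrableOn u (Ioo (-Real.pi) Real.pi) volume →
      LocallyIntegrableOn v (Ioo (-Real.pi) Real.pi) volume := by
    intro u v huv hu
    rw [locallyIntegrableOn_iff isOpen_Ioo.isLocallyClosed] at hu ⊢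
    intro k hk hc
    exact (hu k hk hc).congr (ae_restrict_of_ae_restrict_of_subset hk huv)
  refine ⟨key hf h.1, key hg h.2.1, fun φ h1 h2 h3 => ?_⟩
  rw [integral_congr_ae (g := fun x => deriv φ x • f x)
      (by filter_upwards [hf] with x hx; rw [hx]),
    integral_congr_ae (f := fun x => φ x • g' x) (g := fun x => φ x • g x)
      (by filter_upwards [hg] with x hx; rw [hx])]
  exact h.2.2 φ h1 h2 h3

lemma HasWeakDeriv.add {f₁ f₂ g₁ g₂ : ℝ → ℂ} (h₁ : HasWeakDeriv f₁ g₁)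
    (h₂ : HasWeakDeriv f₂ g₂) : HasWeakDeriv (f₁ + f₂) (g₁ + g₂) := by
  refine ⟨h₁.1.add h₂.1, h₁.2.1.add h₂.2.1, fun φ hφ hc hs => ?_⟩
  have hd : Continuous (deriv φ) := hφ.continuous_deriv (by simp)
  have hs' : tsupport (deriv φ) ⊆ Ioo (-Real.pi) Real.pi :=
    (closure_minimal (support_deriv_subset (f := φ)) (isClosed_tsupport φ)).trans hs
  simp only [Pi.add_apply, smul_add]
  rw [integral_add (integrable_test_smul h₁.1 hd hc.deriv hs')
      (integrable_test_smul h₂.1 hd hc.deriv hs'),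
    integral_add (integrable_test_smul h₁.2.1 hφ.continuous hc hs)
      (integrable_test_smul h₂.2.1 hφ.continuous hc hs),
    h₁.2.2 φ hφ hc hs, h₂.2.2 φ hφ hc hs]
  ring

lemma HasWeakDeriv.const_smul {f g : ℝ → ℂ} (c : ℂ) (h : HasWeakDeriv f g) :
    HasWeakDeriv (c • f) (c • g) := by
  refine ⟨h.1.smul c, h.2.1.smul c, fun φ hφ hc hs => ?_⟩
  simp only [Pi.smul_apply, smul_comm _ c, integral_smul]
  rw [h.2.2 φ hφ hc hs, smul_neg]

lemma hasWeakDeriv_zero : HasWeakDeriv 0 0 := by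
  refine ⟨locallyIntegrableOn_zero, locallyIntegrableOn_zero, fun φ _ _ _ => ?_⟩
  simp

lemma HasWeakDeriv.ae_zero {g : ℝ → ℂ} (h : HasWeakDeriv 0 g) : g =ᵐ[muPi] 0 := by
  have h0 : ∀ᵐ x ∂(volume : Measure ℝ), x ∈ Ioo (-Real.pi) Real.pi → g x = 0 := by
    refine isOpen_Ioo.ae_eq_zero_of_integral_contDiff_smul_eq_zero h.2.1 fun φ hφ hc hs => ?_
    have h1 := h.2.2 φ hφ hc hs
    simp only [Pi.zero_apply, smul_zero, integral_zero] at h1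
    rw [← setIntegral_eq_integral_of_forall_compl_eq_zero (s := Ioo (-Real.pi) Real.pi)]
    · exact neg_eq_zero.1 h1.symm
    · intro x hx
      rw [image_eq_zero_of_notMem_tsupport (fun h => hx (hs h)), zero_smul]
  exact (ae_restrict_iff' measurableSet_Ioo).2 h0

/-- Weak derivatives are unique up to null sets. -/
lemma HasWeakDeriv.ae_unique {f g₁ g₂ : ℝ → ℂ} (h₁ : HasWeakDeriv f g₁)
    (h₂ : HasWeakDeriv f g₂) : g₁ =ᵐ[muPi] g₂ := by
  have h := h₁.add (h₂.const_smul (-1))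
  have h0 : f + (-1 : ℂ) • f = 0 := by simp
  rw [h0] at h
  filter_upwards [h.ae_zero] with x hx
  simpa [sub_eq_zero, ← sub_eq_add_neg] using hx

lemma ae_differentiableAt_of_ac {y : ℝ → ℂ}
    (hy : AbsolutelyContinuousOnInterval y (-Real.pi) Real.pi) :
    ∀ᵐ x ∂muPi, DifferentiableAt ℝ y x := by
  refine (ae_restrict_iff' measurableSet_Ioo).2 ?_
  filter_upwards [hy.boundedVariationOn.ae_differentiableAt_of_mem_uIcc] with x hx hmem
  exact hx (Icc_subset_uIcc (Ioo_subset_Icc_self hmem))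

lemma flux_add (a b : ℝ) {y z : ℝ → ℂ}
    (hy : AbsolutelyContinuousOnInterval y (-Real.pi) Real.pi)
    (hz : AbsolutelyContinuousOnInterval z (-Real.pi) Real.pi) :
    flux a b y + flux a b z =ᵐ[muPi] flux a b (y + z) := by
  filter_upwards [ae_differentiableAt_of_ac hy, ae_differentiableAt_of_ac hz] with x h1 h2
  simp only [flux, Pi.add_apply, deriv_add h1 h2]
  ring

lemma flux_smul (a b : ℝ) (c : ℂ) {y : ℝ → ℂ}
    (hy : AbsolutelyContinuousOnInterval y (-Real.pi) Real.pi) :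
    c • flux a b y =ᵐ[muPi] flux a b (c • y) := by
  filter_upwards [ae_differentiableAt_of_ac hy] with x h1
  simp only [flux, Pi.smul_apply, deriv_const_smul c h1, smul_eq_mul]
  ring

/-! ### The operator -/

/-- The graph of `L`: all pairs `(y, Ly)` in `L² × L²` where `y` is absolutely continuous on
`[-π, π]` with `y(-π) = y(π)` and `Ly = ((1 - a cos x) y + b sin x y')' ∈ L²`. -/
def opGraph (a b : ℝ) : Submodule ℂ (L2 × L2) where
  carrier := {p | ∃ y : ℝ → ℂ, AbsolutelyContinuousOnInterval y (-Real.pi) Real.pi ∧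
    y (-Real.pi) = y Real.pi ∧ p.1 =ᵐ[muPi] y ∧ HasWeakDeriv (flux a b y) p.2}
  add_mem' := by
    rintro p q ⟨y, hy, hyp, hpy, hyw⟩ ⟨z, hz, hzp, hqz, hzw⟩
    refine ⟨y + z, hy.add hz, by simp [hyp, hzp], ?_,
      (hyw.add hzw).congr (flux_add a b hy hz) (Lp.coeFn_add p.2 q.2).symm⟩
    exact (Lp.coeFn_add p.1 q.1).trans (hpy.add hqz)
  zero_mem' := by
    refine ⟨0, ?_, rfl, Lp.coeFn_zero _ _ _, hasWeakDeriv_zero.congr ?_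
      (Lp.coeFn_zero _ _ _).symm⟩
    · simp [AbsolutelyContinuousOnInterval, tendsto_const_nhds]
    · refine Filter.Eventually.of_forall fun x => ?_
      have h0 : deriv (0 : ℝ → ℂ) x = 0 := by simp
      simp [flux, h0]
  smul_mem' := by
    rintro c p ⟨y, hy, hyp, hpy, hyw⟩
    refine ⟨c • y, hy.const_smul c, by simp [hyp], ?_,
      (hyw.const_smul c).congr (flux_smul a b c hy) (Lp.coeFn_smul c p.2).symm⟩
    exact (Lp.coeFn_smul c p.1).trans (hpy.const_smul c)

/-- `Ly` is determined by the class of `y` in `L²`. -/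
lemma opGraph_snd_eq_zero (a b : ℝ) (p : L2 × L2) (hp : p ∈ opGraph a b) (h0 : p.1 = 0) :
    p.2 = 0 := by
  obtain ⟨y, hy, -, hpy, hyw⟩ := hp
  rw [h0] at hpy
  have hle : -Real.pi ≤ Real.pi := by linarith [Real.pi_pos]
  have hy0 : EqOn y 0 (Ioo (-Real.pi) Real.pi) := by
    refine Measure.eqOn_Ioo_of_ae_eq volume (hpy.symm.trans (Lp.coeFn_zero _ _ _)) ?_
      continuousOn_const
    have := hy.continuousOn
    rw [uIcc_of_le hle] at this
    exact this.mono Ioo_subset_Icc_self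
  have hflux : flux a b y =ᵐ[muPi] 0 := by
    refine (ae_restrict_iff' measurableSet_Ioo).2 (Filter.Eventually.of_forall fun x hx => ?_)
    have h1 : y =ᶠ[nhds x] fun _ => 0 := by
      filter_upwards [isOpen_Ioo.mem_nhds hx] with t ht using hy0 ht
    simp [flux, h1.deriv_eq, h1.self_of_nhds]
  exact Lp.ext (((hyw.congr hflux (Filter.EventuallyEq.refl _ _)).ae_zero).trans
    (Lp.coeFn_zero _ _ _).symm)

/-- The operator `L : L² → L²`, `Ly = ((1 - a cos x) y + b sin x y')'`, with domain all
absolutely continuous `2π`-periodic functions `y` such that `Ly ∈ L²`. -/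
def op (a b : ℝ) : L2 →ₗ.[ℂ] L2 := (opGraph a b).toLinearPMap

lemma op_graph (a b : ℝ) : (op a b).graph = opGraph a b :=
  Submodule.toLinearPMap_graph_eq _ (opGraph_snd_eq_zero a b)

/-- The complex vector space `V` is a Hilbert space under the norm `N`: the function `N` is the norm
of an inner product on `V`, and `V` is complete for it. -/
def IsHilbertNorm (V : Type) [AddCommGroup V] [Module ℂ V] (N : V → ℝ) : Prop :=
  ∃ c : InnerProductSpace.Core ℂ V,
    letI : NormedAddCommGroup V := c.toNormedAddCommGroup
    (∀ v : V, ‖v‖ = N v) ∧ CompleteSpace V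

end ConvDiff

end

/-! Let `y` be in the domain and `h = Ly`. The flux has an L² weak derivative, so it agrees a.e.
with an absolutely continuous `W` with `W' = h`. Hence `sin x y'` agrees a.e. with the absolutely
continuous `u = (W - (1 - a cos x) y) / b`, and differentiation gives `b u' + (1 - a cos x) u / sin
x = g` with `g = h - a sin x y` in L². Since `u / sin x = y'` is integrable and `1/x` is not, `u(0)
= 0` (`eq_zero_of_integrable_div_sin`).

The crux is that `u / sin x` is in L². On `(0, π)`, for each real component `r` of `u`,
differentiate the energy `b r² / (sin x + ε)`. By the equation and `2gq ≤ g²/κ + κq²`, its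
derivative is at most `g²/κ - κ q²`, where `q = r / (sin x + ε)` and `κ > 0` is a lower bound of `1
- a cos x + (b/2) cos x`. The energy is zero at `0` and nonnegative at `π`, so the integral of `q²`
is bounded independently of `ε`; Fatou's lemma removes `ε`, and reflection handles `(-π, 0)`
(`integral_sq_div_sin_add_le`, `memLp_div_sin_muPi`). Then `y'` is in L², and solving the equation
for `u'` puts it in L² too (`regularity`). The reverse inclusion is the product rule for weak
derivatives.

For completeness, `f ↦ (f, f', sin x f', (sin x f')')` is a linear isometry into four copies of L².
Its range is cut out by closed conditions: weak derivatives and multiplication by `sin x` are tested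
against smooth functions, and `f(π) = f(-π)` becomes the vanishing of the integral of `f'`
(`equalEndpoints_iff`, `isClosed_jetSet`, `range_jet`). -/

section AbsolutelyContinuous

/-! ### Absolute continuity of complex-valued functions, through real and imaginary parts. -/

open Filter Topology

lemma AbsolutelyContinuousOnInterval.lipschitz_comp {X Y : Type*} [PseudoMetricSpace X]
    [PseudoMetricSpace Y] {f : ℝ → X} {φ : X → Y} {K : NNReal} {a b : ℝ}
    (hφ : LipschitzWith K φ) (hf : AbsolutelyContinuousOnInterval f a b) :
    AbsolutelyContinuousOnInterval (fun x => φ (f x)) a b := by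
  unfold AbsolutelyContinuousOnInterval at hf ⊢
  refine squeeze_zero (fun t => Finset.sum_nonneg fun _ _ => dist_nonneg) (fun t => ?_)
    (by simpa using hf.const_mul (K : ℝ))
  rw [Finset.mul_sum]
  exact Finset.sum_le_sum fun i _ => hφ.dist_le_mul _ _

lemma AbsolutelyContinuousOnInterval.congr {X : Type*} [PseudoMetricSpace X]
    {f g : ℝ → X} {a b : ℝ} (hf : AbsolutelyContinuousOnInterval f a b)
    (h : EqOn f g (uIcc a b)) : AbsolutelyContinuousOnInterval g a b := by
  rw [absolutelyContinuousOnInterval_iff] at hf ⊢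
  intro ε hε
  obtain ⟨δ, hδ, H⟩ := hf ε hε
  refine ⟨δ, hδ, fun E hE hs => ?_⟩
  have h1 := H E hE hs
  refine lt_of_eq_of_lt (Finset.sum_congr rfl fun i hi => ?_) h1
  have h2 := hE.1 i hi
  rw [h h2.1, h h2.2]

lemma AbsolutelyContinuousOnInterval.re {f : ℝ → ℂ} {a b : ℝ}
    (hf : AbsolutelyContinuousOnInterval f a b) :
    AbsolutelyContinuousOnInterval (fun x => (f x).re) a b :=
  hf.lipschitz_comp (φ := Complex.re) Complex.reCLM.lipschitz

lemma AbsolutelyContinuousOnInterval.im {f : ℝ → ℂ} {a b : ℝ}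
    (hf : AbsolutelyContinuousOnInterval f a b) :
    AbsolutelyContinuousOnInterval (fun x => (f x).im) a b :=
  hf.lipschitz_comp (φ := Complex.im) Complex.imCLM.lipschitz

lemma AbsolutelyContinuousOnInterval.ofReal {f : ℝ → ℝ} {a b : ℝ}
    (hf : AbsolutelyContinuousOnInterval f a b) :
    AbsolutelyContinuousOnInterval (fun x => (f x : ℂ)) a b :=
  hf.lipschitz_comp (φ := Complex.ofReal) Complex.ofRealCLM.lipschitz

lemma DifferentiableAt.hasDerivAt_re {f : ℝ → ℂ} {x : ℝ} (h : DifferentiableAt ℝ f x) :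
    HasDerivAt (fun t => (f t).re) (deriv f x).re x :=
  Complex.reCLM.hasFDerivAt.comp_hasDerivAt x h.hasDerivAt

lemma DifferentiableAt.hasDerivAt_im {f : ℝ → ℂ} {x : ℝ} (h : DifferentiableAt ℝ f x) :
    HasDerivAt (fun t => (f t).im) (deriv f x).im x :=
  Complex.imCLM.hasFDerivAt.comp_hasDerivAt x h.hasDerivAt

lemma AbsolutelyContinuousOnInterval.ae_differentiableAt_complex {f : ℝ → ℂ} {a b : ℝ}
    (hf : AbsolutelyContinuousOnInterval f a b) :
    ∀ᵐ x : ℝ, x ∈ uIcc a b → DifferentiableAt ℝ f x :=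
  hf.boundedVariationOn.ae_differentiableAt_of_mem_uIcc

lemma AbsolutelyContinuousOnInterval.ae_deriv_eq {f : ℝ → ℂ} {a b : ℝ}
    (hf : AbsolutelyContinuousOnInterval f a b) :
    ∀ᵐ x : ℝ, x ∈ uIoc a b →
      ((deriv (fun t => (f t).re) x : ℝ) : ℂ) +
        ((deriv (fun t => (f t).im) x : ℝ) : ℂ) * Complex.I = deriv f x := by
  filter_upwards [hf.ae_differentiableAt_complex] with x hx hmem
  have h := hx (uIoc_subset_uIcc hmem)
  rw [h.hasDerivAt_re.deriv, h.hasDerivAt_im.deriv, Complex.re_add_im]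

lemma IntervalIntegrable.complex_ofReal {f : ℝ → ℝ} {a b : ℝ}
    (hf : IntervalIntegrable f volume a b) :
    IntervalIntegrable (fun x => (f x : ℂ)) volume a b :=
  ⟨hf.1.ofReal, hf.2.ofReal⟩

lemma AbsolutelyContinuousOnInterval.intervalIntegrable_deriv_complex {f : ℝ → ℂ} {a b : ℝ}
    (hf : AbsolutelyContinuousOnInterval f a b) :
    IntervalIntegrable (deriv f) volume a b := by
  have h1 := hf.re.intervalIntegrable_deriv.complex_ofReal
  have h2 := (hf.im.intervalIntegrable_deriv.complex_ofReal).mul_const Complex.I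
  refine (h1.add h2).congr_ae ?_
  rw [EventuallyEq, ae_restrict_iff' measurableSet_uIoc]
  exact hf.ae_deriv_eq

lemma AbsolutelyContinuousOnInterval.integral_deriv_eq_sub_complex {f : ℝ → ℂ} {a b : ℝ}
    (hf : AbsolutelyContinuousOnInterval f a b) :
    ∫ x in a..b, deriv f x = f b - f a := by
  rw [← intervalIntegral.integral_congr_ae hf.ae_deriv_eq]
  have h1 := hf.re.intervalIntegrable_deriv.complex_ofReal
  have h2 := (hf.im.intervalIntegrable_deriv.complex_ofReal).mul_const Complex.I
  rw [intervalIntegral.integral_add h1 h2, intervalIntegral.integral_mul_const]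
  erw [intervalIntegral.integral_ofReal, intervalIntegral.integral_ofReal]
  rw [hf.re.integral_deriv_eq_sub, hf.im.integral_deriv_eq_sub]
  apply Complex.ext <;> simp

lemma IntervalIntegrable.absolutelyContinuousOnInterval_integral_complex {g : ℝ → ℂ} {a b c : ℝ}
    (hg : IntervalIntegrable g volume a b) (hc : c ∈ uIcc a b) :
    AbsolutelyContinuousOnInterval (fun x => ∫ v in c..x, g v) a b := by
  have hre : IntervalIntegrable (fun x => (g x).re) volume a b := ⟨hg.1.re, hg.2.re⟩
  have him : IntervalIntegrable (fun x => (g x).im) volume a b := ⟨hg.1.im, hg.2.im⟩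
  have h1 := (hre.absolutelyContinuousOnInterval_intervalIntegral hc).ofReal
  have h2 := (him.absolutelyContinuousOnInterval_intervalIntegral hc).ofReal.const_smul Complex.I
  refine (h1.add h2).congr fun x hx => ?_
  have hi : IntervalIntegrable g volume c x := hg.mono_set (uIcc_subset_uIcc hc hx)
  have hi1 : IntervalIntegrable (fun x => (g x).re) volume c x :=
    hre.mono_set (uIcc_subset_uIcc hc hx)
  have hi2 : IntervalIntegrable (fun x => (g x).im) volume c x :=
    him.mono_set (uIcc_subset_uIcc hc hx)
  simp only [Pi.add_apply, smul_eq_mul]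
  rw [← intervalIntegral.integral_ofReal, ← intervalIntegral.integral_ofReal,
    ← intervalIntegral.integral_const_mul, ← intervalIntegral.integral_add (hi1.complex_ofReal)
      ((hi2.complex_ofReal).const_mul Complex.I)]
  refine intervalIntegral.integral_congr fun t _ => ?_
  simp [mul_comm Complex.I, Complex.re_add_im]

end AbsolutelyContinuous

/-! ### Weak derivatives in one dimension and absolutely continuous representatives. -/

namespace ConvDiff

open Filter Topology

lemma neg_pi_le_pi : -Real.pi ≤ Real.pi := by linarith [Real.pi_pos]

lemma integral_muPi (f : ℝ → ℂ) : ∫ x, f x ∂muPi = ∫ x in -Real.pi..Real.pi, f x := by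
  rw [intervalIntegral.integral_of_le neg_pi_le_pi, integral_Ioc_eq_integral_Ioo]

lemma intervalIntegrable_iff_muPi {f : ℝ → ℂ} :
    IntervalIntegrable f volume (-Real.pi) Real.pi ↔ Integrable f muPi :=
  intervalIntegrable_iff_integrableOn_Ioo_of_le neg_pi_le_pi

lemma ae_muPi_of_uIcc {p : ℝ → Prop} (h : ∀ᵐ x : ℝ, x ∈ uIcc (-Real.pi) Real.pi → p x) :
    ∀ᵐ x ∂muPi, p x := by
  refine (ae_restrict_iff' measurableSet_Ioo).2 ?_
  filter_upwards [h] with x hx hmem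
  exact hx (Icc_subset_uIcc (Ioo_subset_Icc_self hmem))

lemma integrable_deriv_muPi {y : ℝ → ℂ}
    (hy : AbsolutelyContinuousOnInterval y (-Real.pi) Real.pi) : Integrable (deriv y) muPi :=
  intervalIntegrable_iff_muPi.1 hy.intervalIntegrable_deriv_complex

lemma integrable_muPi_of_continuousOn {y : ℝ → ℂ}
    (hy : ContinuousOn y (Icc (-Real.pi) Real.pi)) : Integrable y muPi :=
  (hy.integrableOn_compact isCompact_Icc).mono_set Ioo_subset_Icc_self

lemma continuousOn_Icc_of_ac {y : ℝ → ℂ}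
    (hy : AbsolutelyContinuousOnInterval y (-Real.pi) Real.pi) :
    ContinuousOn y (Icc (-Real.pi) Real.pi) := by
  have := hy.continuousOn
  rwa [uIcc_of_le neg_pi_le_pi] at this

lemma memLp_two_of_continuousOn {y : ℝ → ℂ}
    (hy : ContinuousOn y (Icc (-Real.pi) Real.pi)) : MemLp y 2 muPi := by
  obtain ⟨C, hC⟩ := isCompact_Icc.exists_bound_of_continuousOn hy
  refine MemLp.of_bound (integrable_muPi_of_continuousOn hy).aestronglyMeasurable C ?_
  exact (ae_restrict_iff' measurableSet_Ioo).2
    (Eventually.of_forall fun x hx => hC x (Ioo_subset_Icc_self hx))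

lemma integrable_of_memLp_two {y : ℝ → ℂ} (hy : MemLp y 2 muPi) : Integrable y muPi :=
  hy.integrable (by norm_num)

lemma Integrable.locallyIntegrableOn_Ioo {f : ℝ → ℂ} (hf : Integrable f muPi) :
    LocallyIntegrableOn f (Ioo (-Real.pi) Real.pi) volume :=
  IntegrableOn.locallyIntegrableOn hf

/-- The classical derivative of an absolutely continuous function is its weak derivative. -/
lemma hasWeakDeriv_of_ac {y : ℝ → ℂ}
    (hy : AbsolutelyContinuousOnInterval y (-Real.pi) Real.pi) : HasWeakDeriv y (deriv y) := by
  have h1 := integrable_deriv_muPi hy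
  have h2 := integrable_muPi_of_continuousOn (continuousOn_Icc_of_ac hy)
  refine ⟨Integrable.locallyIntegrableOn_Ioo h2, Integrable.locallyIntegrableOn_Ioo h1,
    fun φ hφ hc hs => ?_⟩
  have hd : Continuous (deriv φ) := hφ.continuous_deriv (by simp)
  have hs' : tsupport (deriv φ) ⊆ Ioo (-Real.pi) Real.pi :=
    (closure_minimal (support_deriv_subset (f := φ)) (isClosed_tsupport φ)).trans hs
  have i1 := integrable_test_smul (Integrable.locallyIntegrableOn_Ioo h2) hd hc.deriv hs'
  have i2 := integrable_test_smul (Integrable.locallyIntegrableOn_Ioo h1) hφ.continuous hc hs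
  have hφac : AbsolutelyContinuousOnInterval φ (-Real.pi) Real.pi :=
    (hφ.of_le (by exact_mod_cast le_top)).contDiffOn.absolutelyContinuousOnInterval
  -- The product is absolutely continuous and vanishes at both endpoints, so the fundamental theorem
  -- of calculus is integration by parts without boundary terms.
  have hac := hφac.smul hy
  have h0 : ∀ t, t ∉ Ioo (-Real.pi) Real.pi → φ t = 0 := fun t ht =>
    image_eq_zero_of_notMem_tsupport fun h => ht (hs h)
  have h3 := hac.integral_deriv_eq_sub_complex
  simp only [Pi.smul_apply', h0 Real.pi (by simp), h0 (-Real.pi) (by simp), zero_smul,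
    sub_zero, ← integral_muPi] at h3
  rw [integral_congr_ae (g := fun x => deriv φ x • y x + φ x • deriv y x)] at h3
  · rw [integral_add i1 i2] at h3
    exact eq_neg_of_add_eq_zero_left h3
  · filter_upwards [ae_muPi_of_uIcc hy.ae_differentiableAt_complex] with x hx
    have h4 : HasDerivAt φ (deriv φ x) x := ((hφ.differentiable (by simp)) x).hasDerivAt
    rw [(h4.smul hx.hasDerivAt).deriv, add_comm]

/-- A test function of integral zero is the derivative of a test function. -/
lemma exists_test_primitive {ψ : ℝ → ℝ} (hψ : ContDiff ℝ ∞ ψ) (hc : HasCompactSupport ψ)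
    (hs : tsupport ψ ⊆ Ioo (-Real.pi) Real.pi) (h0 : ∫ x, ψ x = 0) :
    ∃ Ψ : ℝ → ℝ, ContDiff ℝ ∞ Ψ ∧ HasCompactSupport Ψ ∧
      tsupport Ψ ⊆ Ioo (-Real.pi) Real.pi ∧ deriv Ψ = ψ := by
  -- Compactness leaves a gap between the support and the endpoints; the primitive from `-π` will
  -- live in the same `[-r, r]`.
  obtain ⟨r, hr, hrπ, hr'⟩ : ∃ r : ℝ, 0 ≤ r ∧ r < Real.pi ∧ ∀ x, ψ x ≠ 0 → |x| ≤ r := by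
    rcases (tsupport ψ).eq_empty_or_nonempty with he | hne
    · refine ⟨0, le_rfl, Real.pi_pos, fun x hx => ?_⟩
      have := subset_tsupport ψ hx
      simp [he] at this
    · obtain ⟨x₀, hx₀, hmax⟩ := hc.isCompact.exists_isMaxOn hne continuous_abs.continuousOn
      exact ⟨|x₀|, abs_nonneg _, abs_lt.2 (hs hx₀), fun x hx => hmax (subset_tsupport ψ hx)⟩
  have hd : ∀ x, HasDerivAt (fun x => ∫ t in -Real.pi..x, ψ t) (ψ x) x := fun x =>
    intervalIntegral.integral_hasDerivAt_right (hψ.continuous.intervalIntegrable _ _)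
      (hψ.continuous.stronglyMeasurableAtFilter _ _) hψ.continuous.continuousAt
  have hderiv : deriv (fun x => ∫ t in -Real.pi..x, ψ t) = ψ := funext fun x => (hd x).deriv
  have hsupp : Function.support (fun x => ∫ t in -Real.pi..x, ψ t) ⊆ Icc (-r) r := by
    intro x hx
    by_contra hmem
    refine hx ?_
    rcases lt_or_ge x (-r) with h | h
    -- The case `x < -π`, with reversed limits, is included: both limits lie below `-r`, hence so
    -- does every point between them.
    · refine intervalIntegral.integral_zero_ae (Eventually.of_forall fun t ht => ?_)
      by_contra hne
      have h2 := (abs_le.1 (hr' t hne)).1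
      have h3 : t ≤ max (-Real.pi) x := ht.2
      rcases le_max_iff.1 h3 with h4 | h4 <;> linarith
    · have h' : r < x := by
        by_contra hle
        exact hmem ⟨h, not_lt.1 hle⟩
      simp only
      rw [intervalIntegral.integral_eq_integral_of_support_subset, h0]
      intro t ht
      have := abs_le.1 (hr' t ht)
      constructor <;> linarith [this.1, this.2]
  have htsupp := closure_minimal hsupp isClosed_Icc
  refine ⟨_, contDiff_infty_iff_deriv.2 ⟨fun x => (hd x).differentiableAt, by
    rw [hderiv]; exact hψ⟩,
    HasCompactSupport.of_support_subset_isCompact isCompact_Icc hsupp, htsupp.trans ?_, hderiv⟩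
  exact fun x hx => ⟨by linarith [hx.1], by linarith [hx.2]⟩

lemma exists_test_integral_eq_one : ∃ φ : ℝ → ℝ, ContDiff ℝ ∞ φ ∧ HasCompactSupport φ ∧
    tsupport φ ⊆ Ioo (-Real.pi) Real.pi ∧ ∫ x, φ x = 1 := by
  let f : ContDiffBump (0 : ℝ) := ⟨1, 2, one_pos, one_lt_two⟩
  refine ⟨f.normed volume, f.contDiff_normed, f.hasCompactSupport_normed, ?_, f.integral_normed⟩
  rw [f.tsupport_normed_eq]
  intro x hx
  have h : |x| ≤ 2 := by simpa [Real.dist_eq] using hx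
  have := abs_le.1 h
  constructor <;> linarith [this.1, this.2, Real.pi_gt_three]

/-- A function with vanishing weak derivative is constant. -/
lemma HasWeakDeriv.ae_const {f : ℝ → ℂ} (h : HasWeakDeriv f 0) :
    ∃ c : ℂ, f =ᵐ[muPi] fun _ => c := by
  obtain ⟨φ₀, hφ₀, hc₀, hs₀, h1⟩ := exists_test_integral_eq_one
  set c : ℂ := ∫ x, φ₀ x • f x ∂muPi with hcdef
  have hloc : LocallyIntegrableOn (fun _ : ℝ => c) (Ioo (-Real.pi) Real.pi) volume :=
    (locallyIntegrable_const c).locallyIntegrableOn _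
  refine ⟨c, ?_⟩
  -- Being a weak derivative of `0` says exactly that all test integrals of `f - c` vanish, so
  -- `HasWeakDeriv.ae_zero` serves as the fundamental lemma of the calculus of variations.
  have hw : HasWeakDeriv 0 (f - fun _ => c) := by
    refine ⟨locallyIntegrableOn_zero, h.1.sub hloc, fun φ hφ hc hs => ?_⟩
    have i1 := integrable_test_smul h.1 hφ.continuous hc hs
    have i0 := integrable_test_smul h.1 hφ₀.continuous hc₀ hs₀
    have i2 := integrable_test_smul hloc hφ.continuous hc hs
    have hint : ∫ x, φ x ∂muPi = ∫ x, φ x := by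
      refine setIntegral_eq_integral_of_forall_compl_eq_zero fun x hx => ?_
      exact image_eq_zero_of_notMem_tsupport fun h => hx (hs h)
    -- Subtracting `(∫ φ) φ₀` makes the integral zero; pairing the result with `f` then replaces `∫
    -- φ f` by `(∫ φ) c`.
    obtain ⟨Ψ, hΨ, hcΨ, hsΨ, hdΨ⟩ := exists_test_primitive
      (ψ := fun x => φ x - (∫ t, φ t) * φ₀ x) (hφ.sub (contDiff_const.mul hφ₀))
      (hc.sub (hc₀.mul_left (f := fun _ => ∫ t, φ t)))
      ((tsupport_sub _ _).trans (union_subset hs ((tsupport_mul_subset_right).trans hs₀)))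
      (by
        rw [integral_sub (hφ.continuous.integrable_of_hasCompactSupport hc)
          ((hφ₀.continuous.integrable_of_hasCompactSupport hc₀).const_mul _),
          integral_const_mul, h1]
        ring)
    have h2 := h.2.2 Ψ hΨ hcΨ hsΨ
    simp only [hdΨ, Pi.zero_apply, smul_zero, integral_zero, neg_zero, sub_smul, mul_smul] at h2
    rw [integral_sub i1 (g := fun x => (∫ t, φ t) • φ₀ x • f x) (i0.smul (∫ t, φ t)),
      integral_smul, ← hcdef] at h2
    simp only [Pi.zero_apply, smul_zero, integral_zero, Pi.sub_apply, smul_sub]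
    rw [integral_sub i1 i2, integral_smul_const, hint, h2, neg_zero]
  filter_upwards [hw.ae_zero] with x hx
  simpa [sub_eq_zero] using hx

/-- A function with integrable weak derivative has an absolutely continuous representative. -/
lemma HasWeakDeriv.exists_ac {f g : ℝ → ℂ} (h : HasWeakDeriv f g) (hg : Integrable g muPi) :
    ∃ y : ℝ → ℂ, AbsolutelyContinuousOnInterval y (-Real.pi) Real.pi ∧ f =ᵐ[muPi] y ∧
      deriv y =ᵐ[muPi] g := by
  have hi := intervalIntegrable_iff_muPi.2 hg
  have hac := hi.absolutelyContinuousOnInterval_integral_complex (c := -Real.pi) left_mem_uIcc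
  have hd : deriv (fun x => ∫ v in -Real.pi..x, g v) =ᵐ[muPi] g := by
    filter_upwards [ae_muPi_of_uIcc hi.ae_hasDerivAt_integral] with x hx
    exact (hx _ left_mem_uIcc).deriv
  -- The difference of `f` and the primitive of `g` has weak derivative `0`, so it is constant.
  have hw := h.add (((hasWeakDeriv_of_ac hac).congr (Filter.EventuallyEq.refl _ _) hd).const_smul
    (-1))
  have h0 : g + (-1 : ℂ) • g = 0 := by simp
  rw [h0] at hw
  obtain ⟨c, hc⟩ := hw.ae_const
  have hcac : AbsolutelyContinuousOnInterval (fun _ : ℝ => c) (-Real.pi) Real.pi :=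
    contDiffOn_const.absolutelyContinuousOnInterval
  refine ⟨_, hac.add hcac, ?_, ?_⟩
  · filter_upwards [hc] with x hx
    simp only [Pi.add_apply, Pi.smul_apply, smul_eq_mul] at hx ⊢
    rw [← hx]; ring
  · filter_upwards [hd, ae_muPi_of_uIcc hac.ae_differentiableAt_complex] with x hx h2
    rw [← hx]
    exact (h2.hasDerivAt.add (hasDerivAt_const x c)).deriv.trans (add_zero _)

lemma weakDeriv_ae_eq {f g : ℝ → ℂ} (h : HasWeakDeriv f g) : weakDeriv f =ᵐ[muPi] g := by
  have he : ∃ g, HasWeakDeriv f g := ⟨g, h⟩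
  rw [weakDeriv, dif_pos he]
  exact he.choose_spec.ae_unique h

lemma hasWeakDeriv_weakDeriv {f g : ℝ → ℂ} (h : HasWeakDeriv f g) :
    HasWeakDeriv f (weakDeriv f) :=
  h.congr (EventuallyEq.refl _ _) (weakDeriv_ae_eq h).symm

lemma MemH1.hasWeakDeriv {f : ℝ → ℂ} (h : MemH1 f) : HasWeakDeriv f (weakDeriv f) := by
  obtain ⟨-, g, hg, -⟩ := h
  exact hasWeakDeriv_weakDeriv hg

lemma MemH1.memLp_weakDeriv {f : ℝ → ℂ} (h : MemH1 f) : MemLp (weakDeriv f) 2 muPi := by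
  obtain ⟨-, g, hg, hm⟩ := h
  exact (memLp_congr_ae (weakDeriv_ae_eq hg)).2 hm

lemma MemH1.congr {f f' : ℝ → ℂ} (h : MemH1 f) (hf : f =ᵐ[muPi] f') : MemH1 f' := by
  obtain ⟨hm, g, hg, hgm⟩ := h
  exact ⟨(memLp_congr_ae hf).1 hm, g, hg.congr hf (EventuallyEq.refl _ _), hgm⟩

lemma memH1_of_ac {y : ℝ → ℂ} (hy : AbsolutelyContinuousOnInterval y (-Real.pi) Real.pi)
    (hd : MemLp (deriv y) 2 muPi) : MemH1 y :=
  ⟨memLp_two_of_continuousOn (continuousOn_Icc_of_ac hy), _, hasWeakDeriv_of_ac hy, hd⟩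

end ConvDiff

/-! ### The energy estimate on `(0, π)`. -/

namespace ConvDiff

open Filter Topology

/-- The pointwise inequality behind `integral_sq_div_sin_add_le`. -/
lemma energy_pointwise {b c k κ s ε r R g : ℝ} (hκ : 0 < κ) (hc : 0 ≤ c)
    (hck : κ ≤ c + b / 2 * k) (hs : 0 < s) (hε : 0 < ε) (h : b * R + c * r / s = g) :
    b * ((R * r + r * R) * (s + ε)⁻¹ + r * r * (-k / (s + ε) ^ 2)) ≤
      g ^ 2 / κ - κ * (r / (s + ε)) ^ 2 := by
  have hsε : 0 < s + ε := by positivity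
  obtain ⟨q, rfl⟩ : ∃ q, r = q * (s + ε) := ⟨r / (s + ε), by field_simp⟩
  have h1 : b * ((R * (q * (s + ε)) + q * (s + ε) * R) * (s + ε)⁻¹ +
      q * (s + ε) * (q * (s + ε)) * (-k / (s + ε) ^ 2)) = 2 * q * (b * R) - b * k * q ^ 2 := by
    field_simp
    ring
  have h2 : b * R = g - c * q - c * q * (ε / s) := by
    rw [← h]; field_simp; ring
  -- This is the error of regularizing `1/s` to `1/(s + ε)`; it enters with a minus sign, so it can
  -- be dropped.
  have h3 : 0 ≤ c * q ^ 2 * (ε / s) := by positivity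
  have h4 : q * (s + ε) / (s + ε) = q := by field_simp
  -- Young's inequality `2gq ≤ g²/κ + κq²`, weighted to use up only half of the available `-2κq²`.
  have h5 : 0 ≤ (g - κ * q) ^ 2 / κ := by positivity
  have h6 : (g - κ * q) ^ 2 / κ = g ^ 2 / κ - 2 * g * q + κ * q ^ 2 := by
    field_simp
    ring
  rw [h1, h2, h4]
  nlinarith [mul_le_mul_of_nonneg_right hck (sq_nonneg q)]

/-- The regularized energy estimate for `b r' + (1 - a cos x) r / sin x = g`, `r(0) = 0`. -/
lemma integral_sq_div_sin_add_le {a b κ ε : ℝ} (hb : 0 < b) (hκ : 0 < κ) (hε : 0 < ε)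
    (hc : ∀ x, 0 ≤ 1 - a * Real.cos x)
    (hck : ∀ x, κ ≤ 1 - a * Real.cos x + b / 2 * Real.cos x) {r g : ℝ → ℝ}
    (hr : AbsolutelyContinuousOnInterval r 0 Real.pi) (h0 : r 0 = 0)
    (heq : ∀ᵐ x ∂volume.restrict (Ioo 0 Real.pi),
      b * deriv r x + (1 - a * Real.cos x) * r x / Real.sin x = g x)
    (hg : MemLp g 2 (volume.restrict (Ioo 0 Real.pi))) :
    ∫ x in 0..Real.pi, (r x / (Real.sin x + ε)) ^ 2 ≤
      (∫ x in 0..Real.pi, g x ^ 2 / κ) / κ := by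
  have hpi := Real.pi_pos.le
  have hpos : ∀ x ∈ uIcc 0 Real.pi, 0 < Real.sin x + ε := fun x hx => by
    rw [uIcc_of_le hpi] at hx
    linarith [Real.sin_nonneg_of_mem_Icc hx]
  have hw : AbsolutelyContinuousOnInterval (fun x => (Real.sin x + ε)⁻¹) 0 Real.pi := by
    refine ContDiffOn.absolutelyContinuousOnInterval ?_
    exact ((Real.contDiff_sin.add contDiff_const).contDiffOn).inv fun x hx => (hpos x hx).ne'
  -- The energy `r² / (sin x + ε)`; the shift by `ε` keeps it absolutely continuous up to both
  -- endpoints.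
  have hf := (hr.mul hr).mul hw
  have hi1 : IntervalIntegrable (fun x => (r x / (Real.sin x + ε)) ^ 2) volume 0 Real.pi := by
    refine ContinuousOn.intervalIntegrable ?_
    exact (hr.continuousOn.div (by fun_prop) fun x hx => (hpos x hx).ne').pow 2
  have hi2 : IntervalIntegrable (fun x => g x ^ 2 / κ) volume 0 Real.pi := by
    refine IntervalIntegrable.div_const ?_ κ
    exact (intervalIntegrable_iff_integrableOn_Ioo_of_le hpi).2 hg.integrable_sq
  have hmono := intervalIntegral.integral_mono_ae_restrict hpi
    (hf.intervalIntegrable_deriv.const_mul b) (hi2.sub (hi1.const_mul κ)) (by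
      rw [← restrict_Ioo_eq_restrict_Icc]
      have hd : ∀ᵐ x ∂volume.restrict (Ioo 0 Real.pi), DifferentiableAt ℝ r x := by
        refine (ae_restrict_iff' measurableSet_Ioo).2 ?_
        filter_upwards [hr.ae_differentiableAt] with x hx hmem
        exact hx (Icc_subset_uIcc (Ioo_subset_Icc_self hmem))
      filter_upwards [heq, hd, ae_restrict_mem measurableSet_Ioo] with x h1 h2 h3
      have hs := Real.sin_pos_of_mem_Ioo h3
      have hw' : HasDerivAt (fun x => (Real.sin x + ε)⁻¹)
          (-Real.cos x / (Real.sin x + ε) ^ 2) x :=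
        ((Real.hasDerivAt_sin x).add_const ε).fun_inv (by positivity)
      have hder := ((h2.hasDerivAt.mul h2.hasDerivAt).mul hw').deriv
      rw [hder]
      exact energy_pointwise hκ (hc x) (hck x) hs hε h1)
  rw [intervalIntegral.integral_const_mul, hf.integral_deriv_eq_sub,
    intervalIntegral.integral_sub hi2 (hi1.const_mul κ), intervalIntegral.integral_const_mul] at hmono
  simp only [Pi.mul_apply, h0, Real.sin_pi, zero_mul, sub_zero, zero_add] at hmono
  -- The boundary term at `π` has the favourable sign, so `r(π) = 0` is not required; the one at `0`
  -- vanished with `r(0)`.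
  have h1 : 0 ≤ b * (r Real.pi * r Real.pi * ε⁻¹) :=
    mul_nonneg hb.le (mul_nonneg (mul_self_nonneg _) (by positivity))
  rw [le_div_iff₀ hκ]
  linarith

/-- The regularized bound does not depend on `ε`, so Fatou's lemma along `ε = 1/(n + 1)` passes to
the limit. -/
lemma memLp_div_sin_of_real {a b κ : ℝ} (hb : 0 < b) (hκ : 0 < κ)
    (hc : ∀ x, 0 ≤ 1 - a * Real.cos x)
    (hck : ∀ x, κ ≤ 1 - a * Real.cos x + b / 2 * Real.cos x) {r g : ℝ → ℝ}
    (hr : AbsolutelyContinuousOnInterval r 0 Real.pi) (h0 : r 0 = 0)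
    (heq : ∀ᵐ x ∂volume.restrict (Ioo 0 Real.pi),
      b * deriv r x + (1 - a * Real.cos x) * r x / Real.sin x = g x)
    (hg : MemLp g 2 (volume.restrict (Ioo 0 Real.pi))) :
    MemLp (fun x => r x / Real.sin x) 2 (volume.restrict (Ioo 0 Real.pi)) := by
  have hpi := Real.pi_pos.le
  have hrc : ContinuousOn r (Ioo 0 Real.pi) := by
    have := hr.continuousOn
    rw [uIcc_of_le hpi] at this
    exact this.mono Ioo_subset_Icc_self
  have hm : AEStronglyMeasurable (fun x => r x / Real.sin x) (volume.restrict (Ioo 0 Real.pi)) :=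
    (hrc.div Real.continuous_sin.continuousOn fun x hx =>
      (Real.sin_pos_of_mem_Ioo hx).ne').aestronglyMeasurable measurableSet_Ioo
  rw [memLp_two_iff_integrable_sq hm]
  have hε : ∀ n : ℕ, (0 : ℝ) < 1 / ((n : ℝ) + 1) := fun n => Nat.one_div_pos_of_nat
  have hcont : ∀ n : ℕ, ContinuousOn (fun x => (r x / (Real.sin x + 1 / ((n : ℝ) + 1))) ^ 2)
      (Icc 0 Real.pi) := fun n => by
    have := hr.continuousOn
    rw [uIcc_of_le hpi] at this
    exact (this.div (by fun_prop) fun x hx =>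
      (add_pos_of_nonneg_of_pos (Real.sin_nonneg_of_mem_Icc hx) (hε n)).ne').pow 2
  refine integrable_of_tendsto
    (G := fun (n : ℕ) x => (r x / (Real.sin x + 1 / ((n : ℝ) + 1))) ^ 2) ?_ (fun n => ?_) ?_
  · filter_upwards [ae_restrict_mem measurableSet_Ioo] with x hx
    have hs := (Real.sin_pos_of_mem_Ioo hx).ne'
    have h1 : Tendsto (fun n : ℕ => Real.sin x + 1 / ((n : ℝ) + 1)) atTop (𝓝 (Real.sin x)) := by
      simpa using tendsto_one_div_add_atTop_nhds_zero_nat.const_add (Real.sin x)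
    exact (tendsto_const_nhds.div h1 hs).pow 2
  · exact ((hcont n).mono Ioo_subset_Icc_self).aestronglyMeasurable measurableSet_Ioo
  · refine ne_top_of_le_ne_top (ENNReal.ofReal_ne_top
      (r := (∫ x in 0..Real.pi, g x ^ 2 / κ) / κ)) ?_
    refine liminf_le_of_frequently_le' (Frequently.of_forall fun n => ?_)
    have hint : IntegrableOn (fun x => (r x / (Real.sin x + 1 / ((n : ℝ) + 1))) ^ 2)
        (Ioo 0 Real.pi) :=
      ((hcont n).integrableOn_compact isCompact_Icc).mono_set Ioo_subset_Icc_self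
    rw [← ofReal_integral_norm_eq_lintegral_enorm hint]
    refine ENNReal.ofReal_le_ofReal ?_
    refine le_of_eq_of_le ?_ (integral_sq_div_sin_add_le hb hκ (hε n) hc hck hr h0 heq hg)
    rw [intervalIntegral.integral_of_le hpi, integral_Ioc_eq_integral_Ioo]
    exact integral_congr_ae (Eventually.of_forall fun x => Real.norm_of_nonneg (sq_nonneg _))

/-- The coefficients are real, so the real and imaginary parts satisfy the equation separately. -/
lemma memLp_div_sin {a b κ : ℝ} (hb : 0 < b) (hκ : 0 < κ)
    (hc : ∀ x, 0 ≤ 1 - a * Real.cos x)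
    (hck : ∀ x, κ ≤ 1 - a * Real.cos x + b / 2 * Real.cos x) {u g : ℝ → ℂ}
    (hu : AbsolutelyContinuousOnInterval u 0 Real.pi) (h0 : u 0 = 0)
    (heq : ∀ᵐ x ∂volume.restrict (Ioo 0 Real.pi),
      (b : ℂ) * deriv u x + (1 - a * Real.cos x) * (u x / Real.sin x) = g x)
    (hg : MemLp g 2 (volume.restrict (Ioo 0 Real.pi))) :
    MemLp (fun x => u x / Real.sin x) 2 (volume.restrict (Ioo 0 Real.pi)) := by
  have hd : ∀ᵐ x ∂volume.restrict (Ioo 0 Real.pi), DifferentiableAt ℝ u x := by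
    refine (ae_restrict_iff' measurableSet_Ioo).2 ?_
    filter_upwards [hu.ae_differentiableAt_complex] with x hx hmem
    exact hx (Icc_subset_uIcc (Ioo_subset_Icc_self hmem))
  have hre := memLp_div_sin_of_real hb hκ hc hck hu.re (g := fun x => (g x).re)
    (by simp [h0]) (by
      filter_upwards [heq, hd] with x h1 h2
      rw [h2.hasDerivAt_re.deriv, ← h1, ← Complex.ofReal_one, ← Complex.ofReal_mul,
        ← Complex.ofReal_sub, Complex.add_re, Complex.re_ofReal_mul, Complex.re_ofReal_mul,
        Complex.div_ofReal_re, mul_div_assoc]) hg.re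
  have him := memLp_div_sin_of_real hb hκ hc hck hu.im (g := fun x => (g x).im)
    (by simp [h0]) (by
      filter_upwards [heq, hd] with x h1 h2
      rw [h2.hasDerivAt_im.deriv, ← h1, ← Complex.ofReal_one, ← Complex.ofReal_mul,
        ← Complex.ofReal_sub, Complex.add_im, Complex.im_ofReal_mul, Complex.im_ofReal_mul,
        Complex.div_ofReal_im, mul_div_assoc]) hg.im
  have h1 : MemLp (fun x => (((u x).re / Real.sin x : ℝ) : ℂ)) 2
      (volume.restrict (Ioo 0 Real.pi)) := hre.ofReal
  have h2 : MemLp (fun x => Complex.I * (((u x).im / Real.sin x : ℝ) : ℂ)) 2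
      (volume.restrict (Ioo 0 Real.pi)) := him.ofReal.const_mul Complex.I
  refine (memLp_congr_ae (Eventually.of_forall fun x => ?_)).1 (h1.add h2)
  simp only [Pi.add_apply]
  rw [← Complex.div_ofReal_re, ← Complex.div_ofReal_im, mul_comm]
  exact Complex.re_add_im _

end ConvDiff

/-! ### Regularity across the singular point and the description of the domain. -/

namespace ConvDiff

open Filter Topology

lemma memLp_continuous_mul {k f : ℝ → ℂ} (hk : Continuous k) (hf : MemLp f 2 muPi) :
    MemLp (fun x => k x * f x) 2 muPi := by
  obtain ⟨C, hC⟩ := isCompact_Icc.exists_bound_of_continuousOn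
    (hk.continuousOn (s := Icc (-Real.pi) Real.pi))
  refine hf.of_le_mul (c := C) (hk.aestronglyMeasurable.mul hf.1) ?_
  filter_upwards [ae_restrict_mem measurableSet_Ioo] with x hx
  rw [norm_mul]
  exact mul_le_mul_of_nonneg_right (hC x (Ioo_subset_Icc_self hx)) (norm_nonneg _)

lemma eqOn_Icc_of_ae_muPi {f g : ℝ → ℂ} (h : f =ᵐ[muPi] g)
    (hf : ContinuousOn f (Icc (-Real.pi) Real.pi))
    (hg : ContinuousOn g (Icc (-Real.pi) Real.pi)) : EqOn f g (Icc (-Real.pi) Real.pi) := by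
  refine Measure.eqOn_Icc_of_ae_eq volume (by linarith [Real.pi_pos]) ?_ hf hg
  rwa [← restrict_Ioo_eq_restrict_Icc]

lemma ae_sin_ne_zero : ∀ᵐ x ∂muPi, Real.sin x ≠ 0 := by
  have h0 : ∀ᵐ x : ℝ, x ≠ 0 := by simp [ae_iff]
  filter_upwards [ae_restrict_mem measurableSet_Ioo, ae_restrict_of_ae h0] with x hx hne h
  exact hne ((Real.sin_eq_zero_iff_of_lt_of_lt hx.1 hx.2).1 h)

/-- On the interval, `u(-x)` equals `u(0)` minus the integral of `u'(-t)` from `0` to `x`, hence is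
absolutely continuous. -/
lemma ac_comp_neg {u : ℝ → ℂ} {c : ℝ} (hu : AbsolutelyContinuousOnInterval u (-c) 0) :
    AbsolutelyContinuousOnInterval (fun x => u (-x)) 0 c := by
  have hi : IntervalIntegrable (fun x => deriv u (-x)) volume 0 c := by
    have := (IntervalIntegrable.comp_sub_left hu.intervalIntegrable_deriv_complex 0).symm
    simpa using this
  have hac := hi.absolutelyContinuousOnInterval_integral_complex (c := 0) left_mem_uIcc
  have hconst : AbsolutelyContinuousOnInterval (fun _ : ℝ => u 0) 0 c :=
    contDiffOn_const.absolutelyContinuousOnInterval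
  refine (hconst.sub hac).congr fun x hx => ?_
  have hx' : -x ∈ uIcc (-c) 0 := by
    rcases mem_uIcc.1 hx with h | h
    · exact mem_uIcc.2 (Or.inl ⟨by linarith [h.2], by linarith [h.1]⟩)
    · exact mem_uIcc.2 (Or.inr ⟨by linarith [h.2], by linarith [h.1]⟩)
  have h1 := (hu.mono (uIcc_subset_uIcc hx' right_mem_uIcc)).integral_deriv_eq_sub_complex
  simp only [Pi.sub_apply]
  rw [intervalIntegral.integral_comp_neg, neg_zero, h1]
  ring

/-- If `u(0) ≠ 0`, the quotient is at least `‖u 0‖ / (2|x|)` in norm near `0`, which is not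
integrable. -/
lemma eq_zero_of_integrable_div_sin {u : ℝ → ℂ}
    (hu : ContinuousOn u (Icc (-Real.pi) Real.pi))
    (hi : Integrable (fun x => u x / Real.sin x) muPi) : u 0 = 0 := by
  by_contra hne
  have hpi := Real.pi_pos
  have hpos : 0 < ‖u 0‖ := norm_pos_iff.2 hne
  refine not_intervalIntegrable_of_sub_inv_isBigO_punctured (c := 0)
    (f := fun x => u x / (Real.sin x : ℂ)) ?_ (by linarith : -Real.pi ≠ Real.pi)
    (mem_uIcc.2 (Or.inl ⟨by linarith, hpi.le⟩)) (intervalIntegrable_iff_muPi.2 hi)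
  have hmem : Ioo (-Real.pi) Real.pi ∈ 𝓝 (0 : ℝ) := isOpen_Ioo.mem_nhds ⟨by linarith, hpi⟩
  have hcont : ContinuousAt u 0 := hu.continuousAt (mem_of_superset hmem Ioo_subset_Icc_self)
  have hev : ∀ᶠ x in 𝓝 (0 : ℝ), ‖u 0‖ / 2 < ‖u x‖ :=
    hcont.norm.eventually (lt_mem_nhds (by linarith))
  refine Asymptotics.IsBigO.of_bound (2 / ‖u 0‖) ?_
  filter_upwards [nhdsWithin_le_nhds hev, nhdsWithin_le_nhds hmem, self_mem_nhdsWithin]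
    with x h1 h2 h3
  have hs : Real.sin x ≠ 0 := fun h => h3 ((Real.sin_eq_zero_iff_of_lt_of_lt h2.1 h2.2).1 h)
  rw [sub_zero, norm_inv, norm_div, Complex.norm_real, Real.norm_eq_abs, Real.norm_eq_abs]
  have hs' : |Real.sin x| ≤ |x| := Real.abs_sin_le_abs
  have hsp : 0 < |Real.sin x| := abs_pos.2 hs
  calc |x|⁻¹ ≤ |Real.sin x|⁻¹ := inv_anti₀ hsp hs'
    _ = 1 * |Real.sin x|⁻¹ := (one_mul _).symm
    _ ≤ (2 / ‖u 0‖ * ‖u x‖) * |Real.sin x|⁻¹ := by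
        refine mul_le_mul_of_nonneg_right ?_ (by positivity)
        rw [div_mul_eq_mul_div, le_div_iff₀ hpos]
        linarith
    _ = 2 / ‖u 0‖ * (‖u x‖ / |Real.sin x|) := by ring

/-- If `u` is absolutely continuous with `u(0) = 0` and `b u' + (1 - a cos x) u / sin x` is square
integrable, then so is `u / sin x`. -/
lemma memLp_div_sin_muPi {a b κ : ℝ} (hb : 0 < b) (hκ : 0 < κ)
    (hc : ∀ x, 0 ≤ 1 - a * Real.cos x)
    (hck : ∀ x, κ ≤ 1 - a * Real.cos x + b / 2 * Real.cos x) {u g : ℝ → ℂ}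
    (hu : AbsolutelyContinuousOnInterval u (-Real.pi) Real.pi) (h0 : u 0 = 0)
    (heq : ∀ᵐ x ∂muPi,
      (b : ℂ) * deriv u x + (1 - a * Real.cos x) * (u x / Real.sin x) = g x)
    (hg : MemLp g 2 muPi) : MemLp (fun x => u x / Real.sin x) 2 muPi := by
  have hpi := Real.pi_pos
  have hsub1 : Ioo 0 Real.pi ⊆ Ioo (-Real.pi) Real.pi := Ioo_subset_Ioo (by linarith) le_rfl
  have hsub2 : Ioo (-Real.pi) 0 ⊆ Ioo (-Real.pi) Real.pi := Ioo_subset_Ioo le_rfl hpi.le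
  have m0 : (0 : ℝ) ∈ uIcc (-Real.pi) Real.pi := mem_uIcc.2 (Or.inl ⟨by linarith, hpi.le⟩)
  have hright := memLp_div_sin hb hκ hc hck (hu.mono (uIcc_subset_uIcc m0 right_mem_uIcc)) h0
    (ae_restrict_of_ae_restrict_of_subset hsub1 heq)
    (hg.mono_measure (Measure.restrict_mono hsub1 le_rfl))
  have hpre1 : (fun x : ℝ => -x) ⁻¹' Ioo (-Real.pi) 0 = Ioo 0 Real.pi := by ext x; simp [and_comm]
  have hpre2 : (fun x : ℝ => -x) ⁻¹' Ioo 0 Real.pi = Ioo (-Real.pi) 0 := by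
    ext x; simp [neg_lt]
  have mp1 : MeasurePreserving (fun x : ℝ => -x) (volume.restrict (Ioo 0 Real.pi))
      (volume.restrict (Ioo (-Real.pi) 0)) := by
    have := (Measure.measurePreserving_neg (volume : Measure ℝ)).restrict_preimage
      (measurableSet_Ioo (a := -Real.pi) (b := 0))
    rw [← hpre1]; exact this
  have mp2 : MeasurePreserving (fun x : ℝ => -x) (volume.restrict (Ioo (-Real.pi) 0))
      (volume.restrict (Ioo 0 Real.pi)) := by
    have := (Measure.measurePreserving_neg (volume : Measure ℝ)).restrict_preimage
      (measurableSet_Ioo (a := 0) (b := Real.pi))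
    rw [← hpre2]; exact this
  have hg2 : MemLp (fun x => -g (-x)) 2 (volume.restrict (Ioo 0 Real.pi)) :=
    ((hg.mono_measure (Measure.restrict_mono hsub2 le_rfl)).comp_measurePreserving mp1).neg
  -- Under `x ↦ -x` both `u'` and `1 / sin x` change sign while the coefficient is even, so `u(-x)`
  -- solves the same equation with right-hand side `-g(-x)`.
  have hleft := memLp_div_sin hb hκ hc hck
    (ac_comp_neg (hu.mono (uIcc_subset_uIcc left_mem_uIcc m0))) (by simpa using h0)
    (g := fun x => -g (-x)) (by
      filter_upwards [mp1.quasiMeasurePreserving.ae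
        (ae_restrict_of_ae_restrict_of_subset hsub2 heq)] with x hx
      rw [deriv_comp_neg, ← hx, Real.cos_neg, Real.sin_neg, Complex.ofReal_neg, div_neg]
      ring) hg2
  have hleft' : MemLp (fun x => u x / Real.sin x) 2 (volume.restrict (Ioo (-Real.pi) 0)) := by
    have h := (hleft.comp_measurePreserving mp2).neg
    refine (memLp_congr_ae (Eventually.of_forall fun x => ?_)).1 h
    simp only [Pi.neg_apply, Function.comp_apply, neg_neg, Real.sin_neg, Complex.ofReal_neg,
      div_neg]
  have hm : AEStronglyMeasurable (fun x => u x / (Real.sin x : ℂ)) muPi :=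
    ((integrable_muPi_of_continuousOn (continuousOn_Icc_of_ac hu)).aestronglyMeasurable.aemeasurable.div
      (Complex.continuous_ofReal.comp Real.continuous_sin).aemeasurable).aestronglyMeasurable
  rw [memLp_two_iff_integrable_sq_norm hm]
  have i1 := (memLp_two_iff_integrable_sq_norm hright.1).1 hright
  have i2 := (memLp_two_iff_integrable_sq_norm hleft'.1).1 hleft'
  exact (intervalIntegrable_iff_integrableOn_Ioo_of_le neg_pi_le_pi).1
    (((intervalIntegrable_iff_integrableOn_Ioo_of_le (by linarith)).2 i2).trans
      ((intervalIntegrable_iff_integrableOn_Ioo_of_le hpi.le).2 i1))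

lemma hasDerivAt_one_sub_cos (a x : ℝ) :
    HasDerivAt (fun x : ℝ => 1 - (a : ℂ) * (Real.cos x : ℂ)) ((a : ℂ) * (Real.sin x : ℂ)) x := by
  have h := ((Real.hasDerivAt_cos x).ofReal_comp.const_mul (a : ℂ)).const_sub 1
  simpa using h

lemma contDiff_one_sub_cos (a : ℝ) :
    ContDiff ℝ 1 (fun x : ℝ => 1 - (a : ℂ) * (Real.cos x : ℂ)) :=
  contDiff_const.sub (contDiff_const.mul (Complex.ofRealCLM.contDiff.comp Real.contDiff_cos))

lemma ac_one_sub_cos (a : ℝ) : AbsolutelyContinuousOnInterval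
    (fun x : ℝ => 1 - (a : ℂ) * (Real.cos x : ℂ)) (-Real.pi) Real.pi :=
  (contDiff_one_sub_cos a).contDiffOn.absolutelyContinuousOnInterval

lemma continuous_ofReal_sin : Continuous (fun x : ℝ => (Real.sin x : ℂ)) :=
  Complex.continuous_ofReal.comp Real.continuous_sin

/-- Elements of the domain of the operator are in `H¹`, and so is `sin x · y'`. -/
lemma regularity {a b : ℝ} (ha : 0 < a) (hb : 0 < b) (hab : 2 * a + b < 2) {y h : ℝ → ℂ}
    (hy : AbsolutelyContinuousOnInterval y (-Real.pi) Real.pi)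
    (hw : HasWeakDeriv (flux a b y) h) (hh : MemLp h 2 muPi) :
    MemLp (deriv y) 2 muPi ∧ MemH1 (fun x => (Real.sin x : ℂ) * deriv y x) := by
  obtain ⟨W, hW, hfW, hWd⟩ := hw.exists_ac (integrable_of_memLp_two hh)
  have hb' : (b : ℂ) ≠ 0 := by exact_mod_cast hb.ne'
  -- The flux relation solved for `sin x y'`, with `W` in place of the flux: a representative that
  -- is absolutely continuous through the zeros of `sin`.
  obtain ⟨u, hudef⟩ : ∃ u : ℝ → ℂ, u = fun x => (b : ℂ)⁻¹ •
    (W x - (1 - (a : ℂ) * (Real.cos x : ℂ)) • y x) := ⟨_, rfl⟩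
  have hu : AbsolutelyContinuousOnInterval u (-Real.pi) Real.pi := by
    rw [hudef]
    exact (hW.sub ((ac_one_sub_cos a).smul hy)).const_smul (b : ℂ)⁻¹
  have hud : ∀ᵐ x ∂muPi, (b : ℂ) * deriv u x = h x - ((a : ℂ) * (Real.sin x : ℂ) * y x +
      (1 - (a : ℂ) * (Real.cos x : ℂ)) * deriv y x) := by
    filter_upwards [hWd, ae_differentiableAt_of_ac hW, ae_differentiableAt_of_ac hy]
      with x h1 h2 h3
    have hd : HasDerivAt u ((b : ℂ)⁻¹ • (deriv W x -
        ((1 - (a : ℂ) * (Real.cos x : ℂ)) • deriv y x + ((a : ℂ) * (Real.sin x : ℂ)) • y x))) x := by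
      rw [hudef]
      exact (h2.hasDerivAt.sub
        ((hasDerivAt_one_sub_cos a x).smul h3.hasDerivAt)).const_smul (b : ℂ)⁻¹
    rw [hd.deriv, h1]
    simp only [smul_eq_mul]
    rw [mul_inv_cancel_left₀ hb']
    ring
  have hus : (fun x => (Real.sin x : ℂ) * deriv y x) =ᵐ[muPi] u := by
    filter_upwards [hfW] with x hx
    rw [hudef]
    simp only [flux, smul_eq_mul] at hx ⊢
    rw [← hx]
    field_simp
    ring
  have hy' : (fun x => u x / (Real.sin x : ℂ)) =ᵐ[muPi] deriv y := by
    filter_upwards [hus, ae_sin_ne_zero] with x h1 h2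
    have h3 : (Real.sin x : ℂ) ≠ 0 := by exact_mod_cast h2
    rw [← h1, mul_div_cancel_left₀ _ h3]
  have hu0 : u 0 = 0 := eq_zero_of_integrable_div_sin (continuousOn_Icc_of_ac hu)
    ((integrable_deriv_muPi hy).congr hy'.symm)
  have hyL := memLp_two_of_continuousOn (continuousOn_Icc_of_ac hy)
  have hsy : MemLp (fun x => (a : ℂ) * (Real.sin x : ℂ) * y x) 2 muPi :=
    memLp_continuous_mul (continuous_const.mul continuous_ofReal_sin) hyL
  -- This is the minimum of `1 - (a - b/2) cos x`. From `2a + b < 2` and positivity, `a < 1` and `b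
  -- < 2`, so `|a - b/2| < 1`; `a < 1` also gives `1 - a cos x ≥ 0`.
  have hκ : 0 < 1 - |a - b / 2| := by
    have : |a - b / 2| < 1 := abs_lt.2 ⟨by linarith, by linarith⟩
    linarith
  have hdy : MemLp (deriv y) 2 muPi := by
    refine (memLp_congr_ae hy').1 (memLp_div_sin_muPi (a := a) hb hκ (fun x => ?_) (fun x => ?_) hu hu0
      (g := fun x => h x - (a : ℂ) * (Real.sin x : ℂ) * y x) ?_ (hh.sub hsy))
    · nlinarith [Real.cos_le_one x]
    · have h1 : (a - b / 2) * Real.cos x ≤ |a - b / 2| :=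
        calc (a - b / 2) * Real.cos x ≤ |(a - b / 2) * Real.cos x| := le_abs_self _
          _ = |a - b / 2| * |Real.cos x| := abs_mul _ _
          _ ≤ |a - b / 2| * 1 :=
            mul_le_mul_of_nonneg_left (Real.abs_cos_le_one x) (abs_nonneg _)
          _ = |a - b / 2| := mul_one _
      linarith
    · filter_upwards [hud, hy'] with x h1 h2
      rw [h1, h2]
      ring
  refine ⟨hdy, (memH1_of_ac hu ?_).congr hus.symm⟩
  -- Once `y'` is known to be in L², the equation expresses `u'` through L² functions.
  have h1 : MemLp (fun x => (b : ℂ)⁻¹ * (h x - ((a : ℂ) * (Real.sin x : ℂ) * y x +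
      (1 - (a : ℂ) * (Real.cos x : ℂ)) * deriv y x))) 2 muPi :=
    (hh.sub (hsy.add (memLp_continuous_mul (contDiff_one_sub_cos a).continuous hdy))).const_mul _
  refine (memLp_congr_ae ?_).1 h1
  filter_upwards [hud] with x hx
  rw [← hx, inv_mul_cancel_left₀ hb']

lemma mem_domain_iff {a b : ℝ} (ha : 0 < a) (hb : 0 < b) (hab : 2 * a + b < 2) (f : L2) :
    f ∈ (op a b).domain ↔ MemH1 f ∧ EqualEndpoints f ∧ MemH1 (sinDeriv f) := by
  rw [LinearPMap.mem_domain_iff]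
  simp only [op_graph]
  constructor
  · rintro ⟨h, y, hy, hyp, hfy, hw⟩
    obtain ⟨hd, hs⟩ := regularity ha hb hab hy hw (Lp.memLp h)
    have hfy' : weakDeriv f =ᵐ[muPi] deriv y :=
      weakDeriv_ae_eq ((hasWeakDeriv_of_ac hy).congr hfy.symm (EventuallyEq.refl _ _))
    refine ⟨(memH1_of_ac hy hd).congr hfy.symm, ⟨y, continuousOn_Icc_of_ac hy, hfy, hyp.symm⟩,
      hs.congr ?_⟩
    filter_upwards [hfy'] with x hx
    simp only [sinDeriv, hx]
  · rintro ⟨hf, ⟨g, hgc, hfg, hgp⟩, hs⟩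
    obtain ⟨y, hy, hfy, hyd⟩ := hf.hasWeakDeriv.exists_ac (integrable_of_memLp_two hf.memLp_weakDeriv)
    have hEq := eqOn_Icc_of_ae_muPi (hfy.symm.trans hfg) (continuousOn_Icc_of_ac hy) hgc
    have hyp : y (-Real.pi) = y Real.pi := by
      rw [hEq (left_mem_Icc.2 neg_pi_le_pi), hEq (right_mem_Icc.2 neg_pi_le_pi), hgp]
    -- The two terms of the flux are differentiated separately: the first is absolutely continuous
    -- with L² derivative, the second is `b` times an H¹ function.
    have hky := (ac_one_sub_cos a).smul hy
    have hkd : deriv ((fun x : ℝ => 1 - (a : ℂ) * (Real.cos x : ℂ)) • y) =ᵐ[muPi] fun x =>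
        (1 - (a : ℂ) * (Real.cos x : ℂ)) * weakDeriv f x +
          (a : ℂ) * (Real.sin x : ℂ) * f x := by
      filter_upwards [ae_differentiableAt_of_ac hy, hfy, hyd] with x h1 h2 h3
      rw [((hasDerivAt_one_sub_cos a x).smul h1.hasDerivAt).deriv, h2, h3]
      simp only [smul_eq_mul]
    have hkL : MemLp (fun x => (1 - (a : ℂ) * (Real.cos x : ℂ)) * weakDeriv f x +
        (a : ℂ) * (Real.sin x : ℂ) * f x) 2 muPi :=
      (memLp_continuous_mul (contDiff_one_sub_cos a).continuous hf.memLp_weakDeriv).add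
        (memLp_continuous_mul (continuous_const.mul continuous_ofReal_sin) hf.1)
    have hL := hkL.add (hs.memLp_weakDeriv.const_smul (b : ℂ))
    refine ⟨hL.toLp _, y, hy, hyp, hfy, ?_⟩
    refine (((hasWeakDeriv_of_ac hky).congr (EventuallyEq.refl _ _) hkd).add
      (hs.hasWeakDeriv.const_smul (b : ℂ))).congr ?_ hL.coeFn_toLp.symm
    filter_upwards [hyd] with x hx
    simp only [Pi.add_apply, Pi.smul_apply, smul_eq_mul, Pi.mul_apply, flux, sinDeriv, hx]
    ring

end ConvDiff

/-! ### The Hilbert norm: completeness through a closed range in a product of L² spaces. -/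

namespace ConvDiff

open Filter Topology

/-- A norm pulled back from a Hilbert space along an injective linear map with complete range is
a Hilbert norm. -/
lemma isHilbertNorm_of_linearMap {V E : Type} [AddCommGroup V] [Module ℂ V]
    [NormedAddCommGroup E] [InnerProductSpace ℂ E] (T : V →ₗ[ℂ] E) (hT : Function.Injective T)
    {N : V → ℝ} (hN : ∀ v, ‖T v‖ = N v) (hc : IsComplete (range T)) : IsHilbertNorm V N := by
  let c : InnerProductSpace.Core ℂ V :=
    { inner := fun x y => inner ℂ (T x) (T y)
      conj_inner_symm := fun x y => inner_conj_symm _ _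
      re_inner_nonneg := fun x => inner_self_nonneg
      add_left := fun x y z => by rw [map_add, inner_add_left]
      smul_left := fun x y r => by rw [map_smul, inner_smul_left]
      definite := fun x hx => hT (by rw [inner_self_eq_zero.1 hx, map_zero]) }
  refine ⟨c, ?_⟩
  let _ : NormedAddCommGroup V := c.toNormedAddCommGroup
  have hnorm : ∀ v : V, ‖v‖ = ‖T v‖ := fun v => (norm_eq_sqrt_re_inner (𝕜 := ℂ) (T v)).symm
  refine ⟨fun v => (hnorm v).trans (hN v), ?_⟩
  have hiso : Isometry T := AddMonoidHomClass.isometry_of_norm T fun v => (hnorm v).symm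
  exact hiso.isUniformInducing.completeSpace hc

lemma norm_sq_L2 (f : L2) : ‖f‖ ^ 2 = ∫ x, ‖f x‖ ^ 2 ∂muPi := by
  rw [← inner_self_eq_norm_sq (𝕜 := ℂ), L2.inner_def]
  have h : ∀ x, inner ℂ (f x) (f x) = ((‖f x‖ ^ 2 : ℝ) : ℂ) := fun x => by
    rw [inner_self_eq_norm_sq_to_K]; norm_cast
  simp only [h]
  erw [integral_ofReal]
  exact Complex.ofReal_re _

lemma norm_sq_toLp {f : ℝ → ℂ} (hf : MemLp f 2 muPi) :
    ‖hf.toLp f‖ ^ 2 = ∫ x, ‖f x‖ ^ 2 ∂muPi := by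
  rw [norm_sq_L2]
  exact integral_congr_ae (by filter_upwards [hf.coeFn_toLp] with x hx; rw [hx])

lemma integrable_L2 (f : L2) : Integrable f muPi := integrable_of_memLp_two (Lp.memLp f)

/-- A continuous `k` is bounded on `[-π, π]`, hence in L², and the functional is the inner product
with it. -/
lemma continuous_integral_smul {k : ℝ → ℝ} (hk : Continuous k) :
    Continuous fun f : L2 => ∫ x, k x • f x ∂muPi := by
  have hm : MemLp (fun x => (k x : ℂ)) 2 muPi :=
    memLp_two_of_continuousOn (Complex.continuous_ofReal.comp hk).continuousOn
  have h : (fun f : L2 => ∫ x, k x • f x ∂muPi) = fun f => inner ℂ (hm.toLp _) f := by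
    funext f
    rw [L2.inner_def]
    refine integral_congr_ae ?_
    filter_upwards [hm.coeFn_toLp] with x hx
    rw [hx, RCLike.inner_apply, Complex.conj_ofReal, Complex.real_smul, mul_comm]
  rw [h]
  exact continuous_const.inner continuous_id

/-- Local integrability is automatic in L²; what remains is one equation between continuous
functionals for each test function. -/
lemma isClosed_hasWeakDeriv : IsClosed {p : L2 × L2 | HasWeakDeriv p.1 p.2} := by
  have h : {p : L2 × L2 | HasWeakDeriv p.1 p.2} = ⋂ φ : {φ : ℝ → ℝ // ContDiff ℝ ∞ φ ∧
      HasCompactSupport φ ∧ tsupport φ ⊆ Ioo (-Real.pi) Real.pi},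
      {p : L2 × L2 | ∫ x, deriv φ.1 x • p.1 x ∂muPi = -∫ x, φ.1 x • p.2 x ∂muPi} := by
    ext p
    simp only [mem_iInter, mem_ofPred_eq]
    exact ⟨fun h φ => h.2.2 φ.1 φ.2.1 φ.2.2.1 φ.2.2.2, fun h =>
      ⟨Integrable.locallyIntegrableOn_Ioo (integrable_L2 _),
        Integrable.locallyIntegrableOn_Ioo (integrable_L2 _),
        fun φ h1 h2 h3 => h ⟨φ, h1, h2, h3⟩⟩⟩
  rw [h]
  refine isClosed_iInter fun φ => isClosed_eq ?_ ?_
  · exact (continuous_integral_smul (φ.2.1.continuous_deriv (by simp))).comp continuous_fst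
  · exact ((continuous_integral_smul φ.2.1.continuous).comp continuous_snd).neg

lemma memLp_sin_mul {f : ℝ → ℂ} (hf : MemLp f 2 muPi) :
    MemLp (fun x => (Real.sin x : ℂ) * f x) 2 muPi :=
  memLp_continuous_mul continuous_ofReal_sin hf

/-- Almost everywhere equality is equivalent to equality of all test integrals, and each of these is
a closed condition. -/
lemma isClosed_ae_eq_sin_mul :
    IsClosed {p : L2 × L2 | p.2 =ᵐ[muPi] fun x => (Real.sin x : ℂ) * p.1 x} := by
  have h : {p : L2 × L2 | p.2 =ᵐ[muPi] fun x => (Real.sin x : ℂ) * p.1 x} =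
      ⋂ φ : {φ : ℝ → ℝ // ContDiff ℝ ∞ φ ∧
        HasCompactSupport φ ∧ tsupport φ ⊆ Ioo (-Real.pi) Real.pi},
      {p : L2 × L2 | ∫ x, φ.1 x • p.2 x ∂muPi = ∫ x, (φ.1 x * Real.sin x) • p.1 x ∂muPi} := by
    ext p
    simp only [mem_iInter, mem_ofPred_eq]
    have hs : ∀ (φ : ℝ → ℝ) (x : ℝ), (φ x * Real.sin x) • p.1 x =
        φ x • ((Real.sin x : ℂ) * p.1 x) := fun φ x => by
      rw [mul_smul, Complex.real_smul (x := Real.sin x)]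
    constructor
    · intro h φ
      refine integral_congr_ae ?_
      filter_upwards [h] with x hx
      rw [hx, hs]
    · intro h
      have l1 : LocallyIntegrableOn p.2 (Ioo (-Real.pi) Real.pi) volume :=
        Integrable.locallyIntegrableOn_Ioo (integrable_L2 _)
      have l2 : LocallyIntegrableOn (fun x => (Real.sin x : ℂ) * p.1 x)
          (Ioo (-Real.pi) Real.pi) volume :=
        Integrable.locallyIntegrableOn_Ioo
          (integrable_of_memLp_two (memLp_sin_mul (Lp.memLp p.1)))
      have hw : HasWeakDeriv 0 (p.2 - fun x => (Real.sin x : ℂ) * p.1 x) := by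
        refine ⟨locallyIntegrableOn_zero, l1.sub l2, fun φ h1 h2 h3 => ?_⟩
        have h4 := h ⟨φ, h1, h2, h3⟩
        simp only [hs φ] at h4
        simp only [Pi.zero_apply, smul_zero, integral_zero, Pi.sub_apply, smul_sub]
        rw [integral_sub (integrable_test_smul l1 h1.continuous h2 h3)
          (integrable_test_smul l2 h1.continuous h2 h3), h4, sub_self, neg_zero]
      filter_upwards [hw.ae_zero] with x hx
      simpa [sub_eq_zero] using hx
  rw [h]
  refine isClosed_iInter fun φ => isClosed_eq ?_ ?_
  · exact (continuous_integral_smul φ.2.1.continuous).comp continuous_snd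
  · exact (continuous_integral_smul (φ.2.1.continuous.mul Real.continuous_sin)).comp continuous_fst

/-- The integral of the weak derivative is `y(π) - y(-π)` for the absolutely continuous
representative `y`. This turns the endpoint condition into a continuous functional on L². -/
lemma equalEndpoints_iff {f g : ℝ → ℂ} (h : HasWeakDeriv f g) (hg : Integrable g muPi) :
    EqualEndpoints f ↔ ∫ x, g x ∂muPi = 0 := by
  obtain ⟨y, hy, hfy, hyd⟩ := h.exists_ac hg
  have h1 : ∫ x, g x ∂muPi = y Real.pi - y (-Real.pi) := by
    rw [← integral_congr_ae hyd, integral_muPi, hy.integral_deriv_eq_sub_complex]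
  rw [h1, sub_eq_zero]
  refine ⟨?_, fun he => ⟨y, continuousOn_Icc_of_ac hy, hfy, he⟩⟩
  rintro ⟨k, hk, hfk, hkp⟩
  have hEq := eqOn_Icc_of_ae_muPi (hfy.symm.trans hfk) (continuousOn_Icc_of_ac hy) hk
  rw [hEq (left_mem_Icc.2 neg_pi_le_pi), hEq (right_mem_Icc.2 neg_pi_le_pi), hkp]

/-- The product of four copies of `L²(-π, π)`, with the Hilbert space norm. -/
abbrev L2Jet : Type := PiLp 2 fun _ : Fin 4 => L2

/-- The quadruples `(f, f', sin x f', (sin x f')')`, for `f ∈ H¹` with equal values at the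
endpoints and `sin x f' ∈ H¹`. -/
def jetSet : Set L2Jet :=
  {p | HasWeakDeriv (p 0) (p 1) ∧ ∫ x, p 1 x ∂muPi = 0 ∧
    (p 2 =ᵐ[muPi] fun x => (Real.sin x : ℂ) * p 1 x) ∧ HasWeakDeriv (p 2) (p 3)}

lemma isClosed_jetSet : IsClosed jetSet := by
  have hc : ∀ i : Fin 4, Continuous fun p : L2Jet => p i := fun i =>
    PiLp.continuous_apply 2 (fun _ : Fin 4 => L2) i
  refine ((isClosed_hasWeakDeriv.preimage ((hc 0).prodMk (hc 1))).inter
    (IsClosed.inter ?_ ((isClosed_ae_eq_sin_mul.preimage ((hc 1).prodMk (hc 2))).inter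
      (isClosed_hasWeakDeriv.preimage ((hc 2).prodMk (hc 3))))))
  have h1 := (continuous_integral_smul (k := fun _ => 1) continuous_const).comp (hc 1)
  simp only [one_smul] at h1
  exact isClosed_eq h1 continuous_const

lemma hasWeakDeriv_add_L2 {f₁ f₂ : L2} {g₁ g₂ : ℝ → ℂ} (h₁ : HasWeakDeriv f₁ g₁)
    (h₂ : HasWeakDeriv f₂ g₂) : HasWeakDeriv (f₁ + f₂ : L2) (g₁ + g₂) :=
  (h₁.add h₂).congr (Lp.coeFn_add f₁ f₂).symm (EventuallyEq.refl _ _)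

lemma hasWeakDeriv_smul_L2 (c : ℂ) {f : L2} {g : ℝ → ℂ} (h : HasWeakDeriv f g) :
    HasWeakDeriv (c • f : L2) (c • g) :=
  (h.const_smul c).congr (Lp.coeFn_smul c f).symm (EventuallyEq.refl _ _)

lemma sinDeriv_add_ae {f₁ f₂ : L2} (h₁ : MemH1 f₁) (h₂ : MemH1 f₂) :
    sinDeriv (f₁ + f₂ : L2) =ᵐ[muPi] sinDeriv f₁ + sinDeriv f₂ := by
  filter_upwards [weakDeriv_ae_eq (hasWeakDeriv_add_L2 h₁.hasWeakDeriv h₂.hasWeakDeriv)] with x hx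
  simp only [sinDeriv, Pi.add_apply, hx]
  ring

lemma sinDeriv_smul_ae (c : ℂ) {f : L2} (h : MemH1 f) :
    sinDeriv (c • f : L2) =ᵐ[muPi] c • sinDeriv f := by
  filter_upwards [weakDeriv_ae_eq (hasWeakDeriv_smul_L2 c h.hasWeakDeriv)] with x hx
  simp only [sinDeriv, Pi.smul_apply, smul_eq_mul, hx]
  ring

/-- The linear map `f ↦ (f, f', sin x f', (sin x f')')`. -/
noncomputable def jet (D : Submodule ℂ L2) (h : ∀ f ∈ D, MemH1 f ∧ MemH1 (sinDeriv f)) : D →ₗ[ℂ] L2Jet where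
  toFun f := WithLp.toLp 2 ![(f : L2), (h f f.2).1.memLp_weakDeriv.toLp _,
    (h f f.2).2.1.toLp _, (h f f.2).2.memLp_weakDeriv.toLp _]
  map_add' f g := by
    have hf := h f f.2
    have hg := h g g.2
    ext1 i
    fin_cases i
    · rfl
    · exact MemLp.toLp_congr (h _ (f + g).2).1.memLp_weakDeriv
        (hf.1.memLp_weakDeriv.add hg.1.memLp_weakDeriv)
        (weakDeriv_ae_eq (hasWeakDeriv_add_L2 hf.1.hasWeakDeriv hg.1.hasWeakDeriv))
    · exact MemLp.toLp_congr (h _ (f + g).2).2.1 (hf.2.1.add hg.2.1)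
        (sinDeriv_add_ae hf.1 hg.1)
    · exact MemLp.toLp_congr (h _ (f + g).2).2.memLp_weakDeriv
        (hf.2.memLp_weakDeriv.add hg.2.memLp_weakDeriv)
        (weakDeriv_ae_eq ((hf.2.hasWeakDeriv.add hg.2.hasWeakDeriv).congr
          (sinDeriv_add_ae hf.1 hg.1).symm (EventuallyEq.refl _ _)))
  map_smul' c f := by
    have hf := h f f.2
    ext1 i
    fin_cases i
    · rfl
    · exact MemLp.toLp_congr (h _ (c • f).2).1.memLp_weakDeriv
        (hf.1.memLp_weakDeriv.const_smul c)
        (weakDeriv_ae_eq (hasWeakDeriv_smul_L2 c hf.1.hasWeakDeriv))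
    · exact MemLp.toLp_congr (h _ (c • f).2).2.1 (hf.2.1.const_smul c)
        (sinDeriv_smul_ae c hf.1)
    · exact MemLp.toLp_congr (h _ (c • f).2).2.memLp_weakDeriv
        (hf.2.memLp_weakDeriv.const_smul c)
        (weakDeriv_ae_eq ((hf.2.hasWeakDeriv.const_smul c).congr
          (sinDeriv_smul_ae c hf.1).symm (EventuallyEq.refl _ _)))

lemma norm_jet (D : Submodule ℂ L2) (h : ∀ f ∈ D, MemH1 f ∧ MemH1 (sinDeriv f)) (f : D) :
    ‖jet D h f‖ = √(h1NormSq (f : L2) + h1NormSq (sinDeriv (f : L2))) := by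
  rw [PiLp.norm_eq_of_L2, Fin.sum_univ_four]
  congr 1
  have e0 : ‖jet D h f 0‖ ^ 2 = _ := norm_sq_L2 (f : L2)
  have e1 : ‖jet D h f 1‖ ^ 2 = _ := norm_sq_toLp (h f f.2).1.memLp_weakDeriv
  have e2 : ‖jet D h f 2‖ ^ 2 = _ := norm_sq_toLp (h f f.2).2.1
  have e3 : ‖jet D h f 3‖ ^ 2 = _ := norm_sq_toLp (h f f.2).2.memLp_weakDeriv
  rw [e0, e1, e2, e3, h1NormSq, h1NormSq, add_assoc (_ + _)]

lemma jet_injective (D : Submodule ℂ L2) (h : ∀ f ∈ D, MemH1 f ∧ MemH1 (sinDeriv f)) :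
    Function.Injective (jet D h) := fun _ _ hfg =>
  Subtype.ext (congrArg (fun p : L2Jet => p 0) hfg)

/-- The inclusion that matters is that every quadruple in the closed set is a jet: its first entry
lies in `D`, and uniqueness of weak derivatives then forces the other three. -/
lemma range_jet (D : Submodule ℂ L2)
    (hD : ∀ f : L2, f ∈ D ↔ MemH1 f ∧ EqualEndpoints f ∧ MemH1 (sinDeriv f)) :
    range (jet D fun f hf => ⟨((hD f).1 hf).1, ((hD f).1 hf).2.2⟩) = jetSet := by
  ext p
  constructor
  · rintro ⟨f, rfl⟩
    obtain ⟨h1, h2, h3⟩ := (hD f).1 f.2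
    have c1 := h1.memLp_weakDeriv.coeFn_toLp
    have c2 := h3.1.coeFn_toLp
    have c3 := h3.memLp_weakDeriv.coeFn_toLp
    refine ⟨h1.hasWeakDeriv.congr (EventuallyEq.refl _ _) c1.symm, ?_, ?_,
      h3.hasWeakDeriv.congr c2.symm c3.symm⟩
    · refine (integral_congr_ae c1).trans ?_
      exact (equalEndpoints_iff h1.hasWeakDeriv (integrable_of_memLp_two h1.memLp_weakDeriv)).1 h2
    · refine EventuallyEq.trans c2 ?_
      filter_upwards [c1] with x hx
      simp only [sinDeriv]
      rw [← hx]
      rfl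
  · rintro ⟨h1, h2, h3, h4⟩
    have hw := weakDeriv_ae_eq h1
    have hs : sinDeriv (p 0) =ᵐ[muPi] p 2 := by
      filter_upwards [hw, h3] with x e1 e2
      rw [e2, ← e1, sinDeriv]
    have hw2 := weakDeriv_ae_eq (h4.congr hs.symm (EventuallyEq.refl _ _))
    have hmem : p 0 ∈ D := (hD _).2 ⟨⟨Lp.memLp _, _, h1, Lp.memLp _⟩,
      (equalEndpoints_iff h1 (integrable_L2 _)).2 h2,
      MemH1.congr ⟨Lp.memLp _, _, h4, Lp.memLp _⟩ hs.symm⟩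
    refine ⟨⟨p 0, hmem⟩, ?_⟩
    obtain ⟨g1, -, g3⟩ := (hD _).1 hmem
    ext1 i
    fin_cases i
    · rfl
    · exact Lp.ext (g1.memLp_weakDeriv.coeFn_toLp.trans hw)
    · exact Lp.ext (g3.1.coeFn_toLp.trans hs)
    · exact Lp.ext (g3.memLp_weakDeriv.coeFn_toLp.trans hw2)

end ConvDiff

theorem mainTheorem3 (a b : ℝ) (ha : 0 < a) (hb : 0 < b) (hab : 2 * a + b < 2) :
    ((ConvDiff.op a b).domain : Set ConvDiff.L2) =
      {f : ConvDiff.L2 | ConvDiff.MemH1 f ∧ ConvDiff.EqualEndpoints f ∧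
        ConvDiff.MemH1 (ConvDiff.sinDeriv f)} ∧
    ConvDiff.IsHilbertNorm (ConvDiff.op a b).domain
      (fun f => √(ConvDiff.h1NormSq (f : ConvDiff.L2) +
        ConvDiff.h1NormSq (ConvDiff.sinDeriv (f : ConvDiff.L2)))) := by
  have hD := ConvDiff.mem_domain_iff ha hb hab
  refine ⟨Set.ext hD, ConvDiff.isHilbertNorm_of_linearMap _ (ConvDiff.jet_injective _ _)
    (ConvDiff.norm_jet _ fun f hf => ⟨((hD f).1 hf).1, ((hD f).1 hf).2.2⟩) ?_⟩
  rw [ConvDiff.range_jet _ hD]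
  exact ConvDiff.isClosed_jetSet.isComplete
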